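/- For an integer $N\ge 1$ and real $a,b>0$ put $$\langle f\rangle_{a,b}=\frac1{N!}\int_{[0,1]^N} f(x_1,\dots,x_N)\prod_{i<j}(x_i-x_j)^2\prod_{i=1}^N x_i^{a-1}(1-x_i)^{b-1}\,dx_i ,$$ and for an integer $k\ge 1$ let $I_k=I_k(N;a,b)=\langle p_k\rangle_{a,b}/\langle 1\rangle_{a,b}$, where $p_k=\sum_{i=1}^N x_i^k$. For fixed $N$ and $k$, $I_k(N;a,b)$ is a rational function of $(a,b)$ on the quadrant $a,b>0$; outside this quadrant $I_k(N;a,b)$ denotes the value of that rational function, wherever it is regular. Let $k\ge 1$ be an integer, let $a_0,a_1,b_0,b_1$ be real numbers, and take $a=a_1N+a_0$, $b=b_1N+b_0$. 1. If $a_1=-1$ and $b_1\ne -1$, then $I_k(N;a_1N+a_0,b_1N+b_0)$ is well defined (that is, the rational function is regular at this point and its value there is unique) for all sufficiently large $N$, and $$\lim_{N\to\infty}\frac{I_k(N;a_1N+a_0,\,b_1N+b_0)}{N}=0 .$$ 2. If $b_1=-1$ and $a_1\neq -1$, then $I_k(N;a_1N+a_0,b_1N+b_0)$ is well defined in the same sense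 for all sufficiently large $N$, and $$\lim_{N\to\infty}\frac{I_k(N;a_1N+a_0,\,b_1N+b_0)}{N}=1 .$$ -/

import Mathlib

open Filter Topology

noncomputable section

/-- The unnormalised Jacobi average
`⟨f⟩_{a,b} = (1/N!) ∫_{[0,1]^N} f(x) ∏_{i<j} (x_i - x_j)^2 ∏_i x_i^{a-1} (1-x_i)^{b-1} dx`.
The integrals for `f = 1` converge exactly when `a > 0` and `b > 0`. -/
def jacobiAverage (N : ℕ) (a b : ℝ) (f : (Fin N → ℝ) → ℝ) : ℝ :=
  (1 / (N.factorial : ℝ)) * ∫ x in Set.Icc (0 : Fin N → ℝ) 1,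
    f x * (∏ i, ∏ j ∈ Finset.Ioi i, (x i - x j) ^ 2) *
      ∏ i, (x i ^ (a - 1) * (1 - x i) ^ (b - 1))

/-- The power sum `p_k(x_1, …, x_N) = ∑ x_i^k`. -/
def powerSum (N k : ℕ) (x : Fin N → ℝ) : ℝ := ∑ i, x i ^ k

/-- The ratio of convergent integrals `⟨p_k⟩_{a,b} / ⟨1⟩_{a,b}`, meaningful for `a, b > 0`. -/
def selbergRatio (N k : ℕ) (a b : ℝ) : ℝ :=
  jacobiAverage N a b (powerSum N k) / jacobiAverage N a b (fun _ => 1)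

/-- `c` is the value at `(a, b)` of the rational function of the two parameters that extends
`⟨p_k⟩ / ⟨1⟩` beyond the quadrant of convergence: there is a fraction `P / Q` of real polynomials
in two variables, with `Q a b ≠ 0`, which equals `⟨p_k⟩ / ⟨1⟩` at all points of the open positive
quadrant where `Q` does not vanish, and `c = P a b / Q a b`. -/
def IsContinuedRatio (N k : ℕ) (a b c : ℝ) : Prop :=
  ∃ P Q : MvPolynomial (Fin 2) ℝ,
    MvPolynomial.eval ![a, b] Q ≠ 0 ∧
    (∀ a' b' : ℝ, 0 < a' → 0 < b' → MvPolynomial.eval ![a', b'] Q ≠ 0 →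
      selbergRatio N k a' b' =
        MvPolynomial.eval ![a', b'] P / MvPolynomial.eval ![a', b'] Q) ∧
    c = MvPolynomial.eval ![a, b] P / MvPolynomial.eval ![a, b] Q

open Classical in
/-- `I_k` for `N` variables and real parameters `a, b`: the rational continuation of
`⟨p_k⟩_{a,b} / ⟨1⟩_{a,b}` in the parameters, evaluated at `(a, b)` (and `0` where that continuation
is not regular). -/
def selbergI (N k : ℕ) (a b : ℝ) : ℝ :=
  if h : ∃ c, IsContinuedRatio N k a b c then h.choose else 0

end

/-!
Integrating the divergence of the vector fields `∑ xᵢ ^ (m + 1) (1 - xᵢ) ∂ᵢ` against the Jacobi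
weight gives the loop equations: linear relations, with coefficients polynomial in `a` and `b`,
between the mixed moments `⟨∏_{k ∈ s} p_k / N⟩ / ⟨1⟩` of multisets `s` whose sum is `n + 1` or `n`.
Those indexed by the partitions of `n + 1` form a square system for the moments of sum `n + 1`, so
by Cramer's rule these continue rationally to the points where its determinant does not vanish.

Let `N → ∞` with `a / N → α` and `b / N → β`. The terms that join two parts carry a factor `1 / N²`,
and the matrix of the system tends to `α + β + 2` times the identity plus a matrix that strictly
increases the number of parts, so the determinant tends to a power of `α + β + 2`. If this is not
zero, induction on the sum shows that the continued moments exist for large `N` and factorise in the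
limit into `∏_{k ∈ s} μ k`, where `μ` solves the limiting quadratic recursion. For `α = -1` it is
solved by the moments of the Dirac mass at `0`, for `β = -1` by those of the Dirac mass at `1`.
-/

section WittDerivation

open MvPolynomial Finset

variable {σ R : Type*} [Fintype σ] [CommRing R]

/-- The operator `∑ Xᵢ ^ (m + 1) ∂ᵢ` of the Witt algebra. Loop equations express that the divergence
of the corresponding vector field integrates to zero. -/
noncomputable def wittDerivation (σ R : Type*) [Fintype σ] [CommRing R] (m : ℕ) :
    Derivation R (MvPolynomial σ R) (MvPolynomial σ R) :=
  ∑ i, (X i ^ (m + 1) : MvPolynomial σ R) • pderiv i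

theorem wittDerivation_apply (m : ℕ) (f : MvPolynomial σ R) :
    wittDerivation σ R m f = ∑ i, X i ^ (m + 1) * pderiv i f := by
  have := congrFun (map_sum Derivation.coeFnAddMonoidHom
    (fun i => (X i ^ (m + 1) : MvPolynomial σ R) • pderiv i) univ) f
  rwa [Finset.sum_apply] at this

theorem wittDerivation_X (m : ℕ) (i : σ) : wittDerivation σ R m (X i) = X i ^ (m + 1) := by
  classical
  simp [wittDerivation_apply, pderiv_X, Pi.single_apply]

theorem wittDerivation_psum (m j : ℕ) :
    wittDerivation σ R m (psum σ R j) = j * psum σ R (j + m) := by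
  simp only [psum, map_sum, Derivation.leibniz_pow, wittDerivation_X, smul_eq_mul, nsmul_eq_mul,
    mul_sum]
  refine sum_congr rfl fun i _ => ?_
  rcases j with _ | j
  · simp
  · rw [Nat.add_sub_cancel]
    ring

theorem sum_pderiv_X_pow_mul (m : ℕ) (f : MvPolynomial σ R) :
    ∑ i, pderiv i (X i ^ (m + 1) * f) =
      (m + 1 : MvPolynomial σ R) * psum σ R m * f + wittDerivation σ R m f := by
  simp only [wittDerivation_apply, Derivation.leibniz, Derivation.leibniz_pow, pderiv_X_self,
    smul_eq_mul, nsmul_eq_mul, sum_add_distrib, psum, mul_sum, sum_mul]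
  rw [add_comm]
  congr 1
  refine sum_congr rfl fun i _ => ?_
  push_cast [Nat.add_sub_cancel]
  ring

theorem derivation_prod_eq_prod_mul_sum {A ι : Type*} [CommRing A] [Algebra R A]
    (D : Derivation R A A) (s : Finset ι) (f g : ι → A) (h : ∀ i ∈ s, D (f i) = f i * g i) :
    D (∏ i ∈ s, f i) = (∏ i ∈ s, f i) * ∑ i ∈ s, g i := by
  induction s using Finset.cons_induction with
  | empty => simp
  | cons a s ha ih =>
    rw [forall_mem_cons] at h
    rw [prod_cons, sum_cons, Derivation.leibniz, ih h.2, h.1, smul_eq_mul, smul_eq_mul]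
    ring

theorem sub_mul_sum_antidiagonal {A : Type*} [CommRing A] (x y : A) (m : ℕ) :
    (x - y) * ∑ p ∈ antidiagonal m, x ^ p.1 * y ^ p.2 = x ^ (m + 1) - y ^ (m + 1) := by
  rw [Nat.sum_antidiagonal_eq_sum_range_succ fun i j => x ^ i * y ^ j, mul_comm,
    ← geom_sum₂_mul x y (m + 1), Nat.add_sub_cancel]

variable [LinearOrder σ] [LocallyFiniteOrderTop σ]

/-- The Vandermonde product `Δ = ∏_{i<j} (Xᵢ - Xⱼ)`. -/
noncomputable def vandermondeProd (σ R : Type*) [Fintype σ] [LinearOrder σ]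
    [LocallyFiniteOrderTop σ] [CommRing R] : MvPolynomial σ R :=
  ∏ i, ∏ j ∈ Ioi i, (X i - X j)

theorem vandermondeProd_ne_zero [IsDomain R] : vandermondeProd σ R ≠ 0 :=
  prod_ne_zero_iff.2 fun _ _ => prod_ne_zero_iff.2 fun _ hj =>
    sub_ne_zero.2 <| X_injective.ne (mem_Ioi.1 hj).ne

theorem wittDerivation_vandermondeProd (m : ℕ) :
    wittDerivation σ R m (vandermondeProd σ R) = vandermondeProd σ R *
      ∑ i, ∑ j ∈ Ioi i, ∑ p ∈ antidiagonal m, X i ^ p.1 * X j ^ p.2 := by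
  refine derivation_prod_eq_prod_mul_sum _ _ _ _ fun i _ => ?_
  refine derivation_prod_eq_prod_mul_sum _ _ _ _ fun j _ => ?_
  rw [sub_mul_sum_antidiagonal, map_sub, wittDerivation_X, wittDerivation_X]

theorem sum_antidiagonal_psum_mul_psum [LocallyFiniteOrderBot σ] (m : ℕ) :
    ∑ p ∈ antidiagonal m, psum σ R p.1 * psum σ R p.2 =
      2 * (∑ i, ∑ j ∈ Ioi i, ∑ p ∈ antidiagonal m, X i ^ p.1 * X j ^ p.2) +
        (m + 1 : MvPolynomial σ R) * psum σ R m := by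
  set h : σ → σ → MvPolynomial σ R := fun i j => ∑ p ∈ antidiagonal m, X i ^ p.1 * X j ^ p.2
  have h_symm (i j : σ) : h j i = h i j := by
    simp only [h]
    rw [← Nat.sum_antidiagonal_swap]
    exact sum_congr rfl fun p _ => mul_comm _ _
  have h_diag (i : σ) : h i i = (m + 1 : MvPolynomial σ R) * X i ^ m := by
    simp only [h, ← pow_add]
    rw [sum_congr rfl fun p hp => by rw [mem_antidiagonal.1 hp]]
    simp
  have h_total : ∑ p ∈ antidiagonal m, psum σ R p.1 * psum σ R p.2 = ∑ i, ∑ j, h i j := by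
    simp only [psum, sum_mul_sum, h]
    rw [sum_comm]
    exact sum_congr rfl fun i _ => sum_comm
  have h_pairs : 2 * ∑ i, ∑ j ∈ Ioi i, h i j = ∑ i, ∑ j ∈ {i}ᶜ, h i j := by
    simpa only [h_symm, ← two_mul, ← mul_sum] using sum_sum_Ioi_add_eq_sum_sum_off_diag h
  rw [h_total, h_pairs, psum, mul_sum, ← sum_add_distrib]
  refine sum_congr rfl fun i _ => ?_
  rw [← h_diag, ← sum_compl_add_sum {i}, sum_singleton]

theorem sum_pderiv_X_pow_mul_vandermondeProd_sq [LocallyFiniteOrderBot σ] (m : ℕ)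
    (f : MvPolynomial σ R) :
    ∑ i, pderiv i (X i ^ (m + 1) * (f * vandermondeProd σ R ^ 2)) =
      (wittDerivation σ R m f + f * ∑ p ∈ antidiagonal m, psum σ R p.1 * psum σ R p.2) *
        vandermondeProd σ R ^ 2 := by
  rw [sum_pderiv_X_pow_mul, Derivation.leibniz, Derivation.leibniz_pow,
    wittDerivation_vandermondeProd, sum_antidiagonal_psum_mul_psum]
  simp only [smul_eq_mul, nsmul_eq_mul]
  push_cast
  ring

end WittDerivation

section BetaFunctional

open MvPolynomial ProbabilityTheory

variable {σ : Type*} [Fintype σ] {a b : ℝ}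

theorem beta_add_one (ha : 0 < a) (hb : 0 < b) :
    (a + b) * beta (a + 1) b = a * beta a b := by
  have hab : a + b ≠ 0 := (add_pos ha hb).ne'
  have hΓ : Real.Gamma (a + b) ≠ 0 := (Real.Gamma_pos_of_pos (add_pos ha hb)).ne'
  rw [beta, beta, add_right_comm, Real.Gamma_add_one ha.ne', Real.Gamma_add_one hab]
  field_simp

/-- Integration of polynomials against `∏ xᵢ ^ (a - 1) (1 - xᵢ) ^ (b - 1)` over the unit cube,
given by its values on monomials so that it is linear without any assumption on `a` and `b`. -/
noncomputable def betaFunctional (a b : ℝ) : MvPolynomial σ ℝ →ₗ[ℝ] ℝ :=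
  (basisMonomials σ ℝ).constr ℝ fun e => ∏ i, beta (a + e i) b

theorem betaFunctional_monomial (e : σ →₀ ℕ) (c : ℝ) :
    betaFunctional a b (monomial e c) = c * ∏ i, beta (a + e i) b := by
  have h : monomial e c = c • basisMonomials σ ℝ e := by simp [smul_monomial]
  rw [h, map_smul, betaFunctional, Module.Basis.constr_basis, smul_eq_mul]

theorem betaFunctional_X_mul_monomial (ha : 0 < a) (hb : 0 < b) (i : σ) (e : σ →₀ ℕ) (c : ℝ) :
    (a + b + e i) * betaFunctional a b (X i * monomial e c) =
      (a + e i) * betaFunctional a b (monomial e c) := by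
  classical
  have h_rest : ∏ j ∈ Finset.univ.erase i, beta (a + (Finsupp.single i 1 + e : σ →₀ ℕ) j) b =
      ∏ j ∈ Finset.univ.erase i, beta (a + e j) b :=
    Finset.prod_congr rfl fun j hj => by
      rw [Finsupp.add_apply, Finsupp.single_eq_of_ne (Finset.ne_of_mem_erase hj), zero_add]
  have h_beta := beta_add_one (a := a + e i) (by positivity) hb
  rw [X, monomial_mul, one_mul, betaFunctional_monomial, betaFunctional_monomial,
    ← Finset.mul_prod_erase _ _ (Finset.mem_univ i),
    ← Finset.mul_prod_erase _ _ (Finset.mem_univ i), h_rest, Finsupp.add_apply,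
    Finsupp.single_eq_same, Nat.cast_add, Nat.cast_one, add_comm 1, ← add_assoc]
  linear_combination (c * ∏ j ∈ Finset.univ.erase i, beta (a + e j) b) * h_beta

theorem betaFunctional_X_mul_pderiv (ha : 0 < a) (hb : 0 < b) (i : σ) (P : MvPolynomial σ ℝ) :
    betaFunctional a b (X i * pderiv i P) + a * betaFunctional a b P =
      betaFunctional a b (X i * (X i * pderiv i P)) + (a + b) * betaFunctional a b (X i * P) := by
  induction P using MvPolynomial.induction_on' with
  | monomial e c =>
    rw [X_mul_pderiv_monomial, mul_smul_comm, map_nsmul, map_nsmul, nsmul_eq_mul, nsmul_eq_mul]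
    linear_combination -betaFunctional_X_mul_monomial ha hb i e c
  | add P Q hP hQ =>
    simp only [map_add, mul_add]
    linear_combination hP + hQ

theorem betaFunctional_pderiv_X_mul (ha : 0 < a) (hb : 0 < b) (i : σ) (P : MvPolynomial σ ℝ) :
    betaFunctional a b (pderiv i (X i * P)) + (a - 1) * betaFunctional a b P =
      betaFunctional a b (pderiv i (X i * (X i * P))) +
        (a + b - 2) * betaFunctional a b (X i * P) := by
  simp only [Derivation.leibniz, pderiv_X_self, smul_eq_mul, mul_one, mul_add, map_add]
  linear_combination betaFunctional_X_mul_pderiv ha hb i P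

end BetaFunctional

section BetaIntegral

open MeasureTheory MvPolynomial ProbabilityTheory

theorem exists_eval_ne_zero_of_mem_Ioo {σ : Type*} {P : MvPolynomial σ ℝ} (hP : P ≠ 0) :
    ∃ x : σ → ℝ, (∀ i, x i ∈ Set.Ioo 0 1) ∧ eval x P ≠ 0 := by
  contrapose! hP
  refine funext_set (fun _ => Set.Ioo 0 1) (fun _ => Set.Ioo_infinite one_pos) fun x hx => ?_
  rw [hP x fun i => hx i trivial, map_zero]

variable {σ : Type*} [Fintype σ] {a b : ℝ}

theorem re_cpow_mul_one_sub_cpow (a b : ℝ) {x : ℝ} (hx : x ∈ Set.Ioc 0 1) :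
    RCLike.re ((x : ℂ) ^ ((a : ℂ) - 1) * (1 - (x : ℂ)) ^ ((b : ℂ) - 1)) =
      x ^ (a - 1) * (1 - x) ^ (b - 1) := by
  rw [RCLike.re_to_complex, ← Complex.ofReal_one, ← Complex.ofReal_sub, ← Complex.ofReal_sub,
    ← Complex.ofReal_sub, ← Complex.ofReal_cpow hx.1.le,
    ← Complex.ofReal_cpow (sub_nonneg.2 hx.2), ← Complex.ofReal_mul, Complex.ofReal_re]

theorem integrableOn_cpow_mul_one_sub_cpow (ha : 0 < a) (hb : 0 < b) :
    IntegrableOn (fun x : ℝ => (x : ℂ) ^ ((a : ℂ) - 1) * (1 - (x : ℂ)) ^ ((b : ℂ) - 1))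
      (Set.Ioc 0 1) :=
  (intervalIntegrable_iff_integrableOn_Ioc_of_le zero_le_one).1 <|
    Complex.betaIntegral_convergent (by simpa) (by simpa)

theorem integrableOn_rpow_mul_one_sub_rpow (ha : 0 < a) (hb : 0 < b) :
    IntegrableOn (fun x : ℝ => x ^ (a - 1) * (1 - x) ^ (b - 1)) (Set.Icc 0 1) := by
  rw [integrableOn_Icc_iff_integrableOn_Ioc]
  exact IntegrableOn.congr_fun (integrableOn_cpow_mul_one_sub_cpow ha hb).re
    (fun _ hx => re_cpow_mul_one_sub_cpow a b hx) measurableSet_Ioc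

theorem integral_rpow_mul_one_sub_rpow (ha : 0 < a) (hb : 0 < b) :
    ∫ x in Set.Icc (0 : ℝ) 1, x ^ (a - 1) * (1 - x) ^ (b - 1) = beta a b := by
  rw [beta_eq_betaIntegralReal a b ha hb, Complex.betaIntegral,
    intervalIntegral.integral_of_le zero_le_one, integral_Icc_eq_integral_Ioc,
    ← RCLike.re_to_complex, ← integral_re (integrableOn_cpow_mul_one_sub_cpow ha hb)]
  exact setIntegral_congr_fun measurableSet_Ioc fun x hx => (re_cpow_mul_one_sub_cpow a b hx).symm

theorem pow_mul_rpow_mul_one_sub_rpow_ae_eq (a b : ℝ) (e : ℕ) :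
    (fun x : ℝ => x ^ e * (x ^ (a - 1) * (1 - x) ^ (b - 1)))
      =ᵐ[volume.restrict (Set.Icc 0 1)] fun x => x ^ (a + e - 1) * (1 - x) ^ (b - 1) := by
  rw [← restrict_Ioc_eq_restrict_Icc, EventuallyEq, ae_restrict_iff' measurableSet_Ioc]
  refine Eventually.of_forall fun x hx => ?_
  rw [← mul_assoc, ← Real.rpow_natCast, ← Real.rpow_add hx.1]
  congr 2
  ring

theorem restrict_Icc_zero_one_eq_pi :
    (volume : Measure (σ → ℝ)).restrict (Set.Icc 0 1) =
      Measure.pi fun _ => (volume : Measure ℝ).restrict (Set.Icc 0 1) := by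
  rw [← Set.pi_univ_Icc, volume_pi, Measure.restrict_pi_pi]
  rfl

theorem eval_monomial_mul_prod (e : σ →₀ ℕ) (c : ℝ) (w : ℝ → ℝ) (x : σ → ℝ) :
    eval x (monomial e c) * ∏ i, w (x i) = c * ∏ i, (x i ^ e i * w (x i)) := by
  rw [eval_monomial, Finsupp.prod_fintype _ _ (by simp), Finset.prod_mul_distrib, mul_assoc]

theorem integrableOn_eval_mul_prod_rpow (ha : 0 < a) (hb : 0 < b) (P : MvPolynomial σ ℝ) :
    IntegrableOn (fun x => eval x P * ∏ i, (x i ^ (a - 1) * (1 - x i) ^ (b - 1)))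
      (Set.Icc (0 : σ → ℝ) 1) := by
  induction P using MvPolynomial.induction_on' with
  | monomial e c =>
    simp_rw [eval_monomial_mul_prod e c fun y => y ^ (a - 1) * (1 - y) ^ (b - 1)]
    refine Integrable.const_mul ?_ c
    rw [restrict_Icc_zero_one_eq_pi]
    refine Integrable.fintype_prod_dep
      (f := fun i y => y ^ e i * (y ^ (a - 1) * (1 - y) ^ (b - 1))) fun i => ?_
    exact (integrable_congr (pow_mul_rpow_mul_one_sub_rpow_ae_eq a b (e i))).2
      (integrableOn_rpow_mul_one_sub_rpow (by positivity) hb)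
  | add P Q hP hQ =>
    simp only [map_add, add_mul]
    exact hP.add hQ

theorem integral_eval_mul_prod_rpow (ha : 0 < a) (hb : 0 < b) (P : MvPolynomial σ ℝ) :
    ∫ x in Set.Icc (0 : σ → ℝ) 1, eval x P * ∏ i, (x i ^ (a - 1) * (1 - x i) ^ (b - 1)) =
      betaFunctional a b P := by
  induction P using MvPolynomial.induction_on' with
  | monomial e c =>
    simp_rw [eval_monomial_mul_prod e c fun y => y ^ (a - 1) * (1 - y) ^ (b - 1)]
    rw [betaFunctional_monomial, integral_const_mul, restrict_Icc_zero_one_eq_pi,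
      integral_fintype_prod_eq_prod fun i y => y ^ e i * (y ^ (a - 1) * (1 - y) ^ (b - 1))]
    congr! 2 with i
    rw [integral_congr_ae (pow_mul_rpow_mul_one_sub_rpow_ae_eq a b (e i)),
      integral_rpow_mul_one_sub_rpow (by positivity) hb]
  | add P Q hP hQ =>
    rw [map_add, ← hP, ← hQ, ← integral_add (integrableOn_eval_mul_prod_rpow ha hb P)
      (integrableOn_eval_mul_prod_rpow ha hb Q)]
    simp only [map_add, add_mul]

theorem betaFunctional_sq_pos (ha : 0 < a) (hb : 0 < b) {P : MvPolynomial σ ℝ} (hP : P ≠ 0) :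
    0 < betaFunctional a b (P ^ 2) := by
  have h_nonneg : ∀ x ∈ Set.Icc (0 : σ → ℝ) 1,
      0 ≤ eval x (P ^ 2) * ∏ i, (x i ^ (a - 1) * (1 - x i) ^ (b - 1)) := fun x hx => by
    rw [map_pow]
    exact mul_nonneg (sq_nonneg _) <| Finset.prod_nonneg fun i _ =>
      mul_nonneg (Real.rpow_nonneg (hx.1 i) _) (Real.rpow_nonneg (sub_nonneg.2 (hx.2 i)) _)
  rw [← integral_eval_mul_prod_rpow ha hb, setIntegral_pos_iff_support_of_nonneg_ae
    (ae_restrict_of_forall_mem measurableSet_Icc h_nonneg)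
    (integrableOn_eval_mul_prod_rpow ha hb _)]
  have h_open : IsOpen ((Set.univ.pi fun _ : σ => Set.Ioo (0 : ℝ) 1) ∩ {x | eval x P ≠ 0}) :=
    (isOpen_set_pi Set.finite_univ fun _ _ => isOpen_Ioo).inter
      (isOpen_ne_fun P.continuous_eval continuous_const)
  obtain ⟨x₀, hx₀, hPx₀⟩ := exists_eval_ne_zero_of_mem_Ioo hP
  refine (h_open.measure_pos volume ⟨x₀, fun i _ => hx₀ i, hPx₀⟩).trans_le (measure_mono ?_)
  rintro x ⟨hx, hPx⟩
  have hx' (i : σ) : x i ∈ Set.Ioo 0 1 := hx i trivial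
  refine ⟨?_, fun i => (hx' i).1.le, fun i => (hx' i).2.le⟩
  rw [Function.mem_support, map_pow]
  exact mul_ne_zero (pow_ne_zero _ hPx) <| Finset.prod_ne_zero_iff.2 fun i _ =>
    mul_ne_zero (Real.rpow_pos_of_pos (hx' i).1 _).ne'
      (Real.rpow_pos_of_pos (sub_pos.2 (hx' i).2) _).ne'

end BetaIntegral

section JacobiMean

open MvPolynomial Finset

variable {N : ℕ} {a b : ℝ}

/-- The normalised Jacobi average `⟨f⟩_{a,b} / ⟨1⟩_{a,b}` of a polynomial `f` in `N` variables. -/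
noncomputable def jacobiMean (N : ℕ) (a b : ℝ) : MvPolynomial (Fin N) ℝ →ₗ[ℝ] ℝ :=
  (betaFunctional a b (vandermondeProd (Fin N) ℝ ^ 2))⁻¹ •
    betaFunctional a b ∘ₗ LinearMap.mulRight ℝ (vandermondeProd (Fin N) ℝ ^ 2)

theorem jacobiMean_apply (f : MvPolynomial (Fin N) ℝ) :
    jacobiMean N a b f = betaFunctional a b (f * vandermondeProd (Fin N) ℝ ^ 2) /
      betaFunctional a b (vandermondeProd (Fin N) ℝ ^ 2) := by
  rw [div_eq_inv_mul]
  rfl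

theorem jacobiMean_one (ha : 0 < a) (hb : 0 < b) : jacobiMean N a b 1 = 1 := by
  rw [jacobiMean_apply, one_mul,
    div_self (betaFunctional_sq_pos ha hb vandermondeProd_ne_zero).ne']

theorem jacobiAverage_eval (ha : 0 < a) (hb : 0 < b) (f : MvPolynomial (Fin N) ℝ) :
    jacobiAverage N a b (fun x => eval x f) =
      1 / (N.factorial : ℝ) * betaFunctional a b (f * vandermondeProd (Fin N) ℝ ^ 2) := by
  rw [jacobiAverage, ← integral_eval_mul_prod_rpow ha hb]
  simp only [vandermondeProd, map_mul, map_pow, map_prod, map_sub, eval_X, prod_pow]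

theorem selbergRatio_eq_jacobiMean (ha : 0 < a) (hb : 0 < b) (k : ℕ) :
    selbergRatio N k a b = jacobiMean N a b (psum (Fin N) ℝ k) := by
  have h_psum : powerSum N k = fun x => eval x (psum (Fin N) ℝ k) := by
    ext x
    simp [psum, powerSum]
  have h_one : (fun _ => 1 : (Fin N → ℝ) → ℝ) = fun x => eval x 1 := by simp
  rw [selbergRatio, h_psum, h_one, jacobiAverage_eval ha hb, jacobiAverage_eval ha hb, one_mul,
    jacobiMean_apply, mul_div_mul_left _ _ (by positivity)]

theorem betaFunctional_loop_equation {σ : Type*} [Fintype σ] [LinearOrder σ]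
    [LocallyFiniteOrderTop σ] [LocallyFiniteOrderBot σ] (ha : 0 < a) (hb : 0 < b) (m : ℕ)
    (f : MvPolynomial σ ℝ) :
    betaFunctional a b ((wittDerivation σ ℝ (m + 1) f +
          f * ∑ p ∈ antidiagonal (m + 1), psum σ ℝ p.1 * psum σ ℝ p.2) *
            vandermondeProd σ ℝ ^ 2) +
        (a + b - 2) * betaFunctional a b (psum σ ℝ (m + 1) * f * vandermondeProd σ ℝ ^ 2) =
      betaFunctional a b ((wittDerivation σ ℝ m f +
          f * ∑ p ∈ antidiagonal m, psum σ ℝ p.1 * psum σ ℝ p.2) * vandermondeProd σ ℝ ^ 2) +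
        (a - 1) * betaFunctional a b (psum σ ℝ m * f * vandermondeProd σ ℝ ^ 2) := by
  have h_psum (j : ℕ) : psum σ ℝ j * f * vandermondeProd σ ℝ ^ 2 =
      ∑ i, X i ^ j * (f * vandermondeProd σ ℝ ^ 2) := by
    rw [mul_assoc, psum, sum_mul]
  rw [← sum_pderiv_X_pow_mul_vandermondeProd_sq, ← sum_pderiv_X_pow_mul_vandermondeProd_sq,
    h_psum, h_psum]
  simp only [map_sum, mul_sum, ← sum_add_distrib]
  refine sum_congr rfl fun i _ => ?_
  have h := betaFunctional_pderiv_X_mul ha hb i (X i ^ m * (f * vandermondeProd σ ℝ ^ 2))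
  simp only [← mul_assoc, ← pow_succ'] at h ⊢
  exact h.symm

theorem jacobiMean_loop_equation (ha : 0 < a) (hb : 0 < b) (m : ℕ) (f : MvPolynomial (Fin N) ℝ) :
    jacobiMean N a b (wittDerivation (Fin N) ℝ (m + 1) f +
          f * ∑ p ∈ antidiagonal (m + 1), psum (Fin N) ℝ p.1 * psum (Fin N) ℝ p.2) +
        (a + b - 2) * jacobiMean N a b (psum (Fin N) ℝ (m + 1) * f) =
      jacobiMean N a b (wittDerivation (Fin N) ℝ m f +
          f * ∑ p ∈ antidiagonal m, psum (Fin N) ℝ p.1 * psum (Fin N) ℝ p.2) +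
        (a - 1) * jacobiMean N a b (psum (Fin N) ℝ m * f) := by
  simp only [jacobiMean_apply, mul_div_assoc', ← add_div]
  rw [betaFunctional_loop_equation ha hb]

end JacobiMean

section SplitsAndJoins

open Finset.HasAntidiagonal

variable {k m : ℕ} {l t : Multiset ℕ}

/-- The multisets arising from `m ::ₘ l` by splitting the part `m` into two ordered, possibly zero,
parts. -/
def splits (m : ℕ) (l : Multiset ℕ) : Multiset (Multiset ℕ) :=
  (antidiagonal m).val.map fun p => p.1 ::ₘ p.2 ::ₘ l

/-- The multisets arising from `(m + 1) ::ₘ l` by splitting the part `m + 1` into two ordered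
positive parts. -/
def positiveSplits (m : ℕ) (l : Multiset ℕ) : Multiset (Multiset ℕ) :=
  (Multiset.range m).map fun s => (s + 1) ::ₘ (m - s) ::ₘ l

/-- The multisets arising from `k ::ₘ l` by merging `k` with one of the parts `j` of `l`, each
taken with multiplicity `j`. -/
def joins (k : ℕ) (l : Multiset ℕ) : Multiset (Multiset ℕ) :=
  l.bind fun j => Multiset.replicate j ((j + k) ::ₘ l.erase j)

theorem splits_succ (m : ℕ) (l : Multiset ℕ) :
    splits (m + 1) l = Multiset.replicate 2 (0 ::ₘ (m + 1) ::ₘ l) + positiveSplits m l := by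
  have h_range : (antidiagonal m).val = (Multiset.range (m + 1)).map fun i => (i, m - i) := by
    rw [Finset.Nat.antidiagonal_eq_map]
    rfl
  rw [splits, Finset.Nat.antidiagonal_succ, Finset.cons_val, Finset.map_val, h_range,
    Multiset.range_succ, positiveSplits]
  simp [Multiset.cons_swap (m + 1) 0, Multiset.replicate_succ]

theorem mem_splits : t ∈ splits m l ↔ ∃ i j, i + j = m ∧ i ::ₘ j ::ₘ l = t := by
  simp [splits]

theorem mem_positiveSplits :
    t ∈ positiveSplits m l ↔ ∃ s < m, (s + 1) ::ₘ (m - s) ::ₘ l = t := by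
  simp [positiveSplits]

theorem mem_joins : t ∈ joins k l ↔ ∃ j ∈ l, j ≠ 0 ∧ t = (j + k) ::ₘ l.erase j := by
  simp [joins, Multiset.mem_replicate]

theorem joins_zero (k : ℕ) : joins k 0 = 0 := rfl

theorem joins_cons (k a : ℕ) (l : Multiset ℕ) :
    joins k (a ::ₘ l) = Multiset.replicate a ((a + k) ::ₘ l) + (joins k l).map (a ::ₘ ·) := by
  simp only [joins, Multiset.cons_bind, Multiset.erase_cons_head, Multiset.map_bind,
    Multiset.map_replicate]
  congr 1
  refine Multiset.bind_congr fun j hj => ?_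
  rw [Multiset.cons_swap]
  rcases eq_or_ne a j with rfl | h_ne
  · rw [Multiset.erase_cons_head, Multiset.cons_erase hj]
  · rw [Multiset.erase_cons_tail _ h_ne]

theorem sum_of_mem_splits (ht : t ∈ splits m l) : t.sum = m + l.sum := by
  obtain ⟨i, j, hij, rfl⟩ := mem_splits.1 ht
  rw [Multiset.sum_cons, Multiset.sum_cons, ← add_assoc, hij]

theorem card_of_mem_positiveSplits (ht : t ∈ positiveSplits m l) : t.card = l.card + 2 := by
  obtain ⟨s, -, rfl⟩ := mem_positiveSplits.1 ht
  rw [Multiset.card_cons, Multiset.card_cons]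

theorem sum_of_mem_positiveSplits (ht : t ∈ positiveSplits m l) : t.sum = m + 1 + l.sum := by
  obtain ⟨s, hs, rfl⟩ := mem_positiveSplits.1 ht
  rw [Multiset.sum_cons, Multiset.sum_cons]
  omega

theorem pos_of_mem_positiveSplits (ht : t ∈ positiveSplits m l) (hl : ∀ i ∈ l, 0 < i) :
    ∀ i ∈ t, 0 < i := by
  obtain ⟨s, hs, rfl⟩ := mem_positiveSplits.1 ht
  rw [Multiset.forall_mem_cons, Multiset.forall_mem_cons]
  exact ⟨s.succ_pos, Nat.sub_pos_of_lt hs, hl⟩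

theorem sum_of_mem_joins (ht : t ∈ joins k l) : t.sum = k + l.sum := by
  obtain ⟨j, hj, -, rfl⟩ := mem_joins.1 ht
  rw [← Multiset.sum_erase hj, Multiset.sum_cons]
  omega

theorem pos_of_mem_joins (ht : t ∈ joins k l) (hl : ∀ i ∈ l, 0 < i) : ∀ i ∈ t, 0 < i := by
  obtain ⟨j, -, h0, rfl⟩ := mem_joins.1 ht
  exact Multiset.forall_mem_cons.2 ⟨by omega, fun i hi => hl i (Multiset.mem_of_mem_erase hi)⟩

theorem sum_map_prod_splits {R : Type*} [CommSemiring R] (f : ℕ → R) (m : ℕ) (l : Multiset ℕ) :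
    ((splits m l).map fun t => (t.map f).prod).sum =
      (∑ p ∈ antidiagonal m, f p.1 * f p.2) * (l.map f).prod := by
  simp only [splits, Multiset.map_map, Function.comp_def, Multiset.map_cons, Multiset.prod_cons,
    ← mul_assoc, Multiset.sum_map_mul_right, Finset.sum]

end SplitsAndJoins

section JacobiMoments

open MvPolynomial Finset.HasAntidiagonal

variable {N : ℕ} {a b : ℝ}

/-- The `k`-th moment `N⁻¹ ∑ Xᵢ ^ k` of the empirical measure. -/
noncomputable def empiricalMoment (N k : ℕ) : MvPolynomial (Fin N) ℝ :=
  (N : ℝ)⁻¹ • psum (Fin N) ℝ k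

theorem smul_empiricalMoment (hN : N ≠ 0) (k : ℕ) :
    (N : ℝ) • empiricalMoment N k = psum (Fin N) ℝ k :=
  smul_inv_smul₀ (Nat.cast_ne_zero.2 hN) _

theorem empiricalMoment_zero (hN : N ≠ 0) : empiricalMoment N 0 = 1 := by
  rw [empiricalMoment, psum_zero, Fintype.card_fin, inv_smul_eq_iff₀ (Nat.cast_ne_zero.2 hN),
    Algebra.smul_def, mul_one, map_natCast]

theorem wittDerivation_empiricalMoment (m k : ℕ) :
    wittDerivation (Fin N) ℝ m (empiricalMoment N k) = k • empiricalMoment N (k + m) := by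
  rw [empiricalMoment, Derivation.map_smul, wittDerivation_psum, ← nsmul_eq_mul, smul_comm,
    empiricalMoment]

theorem wittDerivation_prod_empiricalMoment (m : ℕ) (l : Multiset ℕ) :
    wittDerivation (Fin N) ℝ m (l.map (empiricalMoment N)).prod =
      ((joins m l).map fun t => (t.map (empiricalMoment N)).prod).sum := by
  induction l using Multiset.induction with
  | empty => simp [joins_zero]
  | cons a l ih =>
    simp only [Multiset.map_cons, Multiset.prod_cons, Derivation.leibniz, ih,
      wittDerivation_empiricalMoment, joins_cons, Multiset.map_add, Multiset.map_replicate,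
      Multiset.map_map, Multiset.sum_add, Function.comp_def, Multiset.sum_replicate,
      Multiset.sum_map_mul_left, smul_eq_mul, nsmul_eq_mul]
    ring

/-- The mixed moment `⟨∏_{k ∈ s} (p_k / N)⟩_{a,b} / ⟨1⟩_{a,b}`. -/
noncomputable def jacobiMoment (N : ℕ) (s : Multiset ℕ) (a b : ℝ) : ℝ :=
  jacobiMean N a b (s.map (empiricalMoment N)).prod

theorem jacobiMoment_zero (ha : 0 < a) (hb : 0 < b) : jacobiMoment N 0 a b = 1 := by
  rw [jacobiMoment, Multiset.map_zero, Multiset.prod_zero, jacobiMean_one ha hb]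

theorem jacobiMoment_zero_cons (hN : N ≠ 0) (s : Multiset ℕ) :
    jacobiMoment N (0 ::ₘ s) a b = jacobiMoment N s a b := by
  rw [jacobiMoment, Multiset.map_cons, Multiset.prod_cons, empiricalMoment_zero hN, one_mul,
    jacobiMoment]

theorem selbergRatio_eq_mul_jacobiMoment (hN : N ≠ 0) (ha : 0 < a) (hb : 0 < b) (k : ℕ) :
    selbergRatio N k a b = N * jacobiMoment N {k} a b := by
  rw [selbergRatio_eq_jacobiMean ha hb, ← smul_empiricalMoment hN, map_smul, smul_eq_mul,
    jacobiMoment, Multiset.map_singleton, Multiset.prod_singleton]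

theorem jacobiMean_sum_map (T : Multiset (Multiset ℕ)) :
    jacobiMean N a b (T.map fun t => (t.map (empiricalMoment N)).prod).sum =
      (T.map fun t => jacobiMoment N t a b).sum := by
  rw [map_multiset_sum, Multiset.map_map]
  rfl

theorem jacobiMoment_loop_equation (hN : N ≠ 0) (ha : 0 < a) (hb : 0 < b) (m : ℕ)
    (l : Multiset ℕ) :
    (a + b - 2) / N * jacobiMoment N ((m + 1) ::ₘ l) a b +
        ((splits (m + 1) l).map fun t => jacobiMoment N t a b).sum +
        ((N : ℝ) ^ 2)⁻¹ * ((joins (m + 1) l).map fun t => jacobiMoment N t a b).sum =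
      (a - 1) / N * jacobiMoment N (m ::ₘ l) a b +
        ((splits m l).map fun t => jacobiMoment N t a b).sum +
        ((N : ℝ) ^ 2)⁻¹ * ((joins m l).map fun t => jacobiMoment N t a b).sum := by
  have h_divergence (j : ℕ) :
      jacobiMean N a b (wittDerivation (Fin N) ℝ j (l.map (empiricalMoment N)).prod +
        (l.map (empiricalMoment N)).prod *
          ∑ p ∈ antidiagonal j, psum (Fin N) ℝ p.1 * psum (Fin N) ℝ p.2) =
      ((joins j l).map fun t => jacobiMoment N t a b).sum +
        N ^ 2 * ((splits j l).map fun t => jacobiMoment N t a b).sum := by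
    simp only [← smul_empiricalMoment hN, smul_mul_assoc, mul_smul_comm, ← Finset.smul_sum,
      map_add, map_smul, smul_eq_mul, mul_comm (l.map (empiricalMoment N)).prod]
    rw [← sum_map_prod_splits, wittDerivation_prod_empiricalMoment, jacobiMean_sum_map,
      jacobiMean_sum_map, sq, mul_assoc]
  have h_psum (j : ℕ) :
      jacobiMean N a b (psum (Fin N) ℝ j * (l.map (empiricalMoment N)).prod) =
        N * jacobiMoment N (j ::ₘ l) a b := by
    rw [← smul_empiricalMoment hN, smul_mul_assoc, map_smul, smul_eq_mul, jacobiMoment,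
      Multiset.map_cons, Multiset.prod_cons]
  have h_loop := jacobiMean_loop_equation ha hb m (l.map (empiricalMoment N)).prod
  rw [h_divergence, h_divergence, h_psum, h_psum] at h_loop
  have hN' : (N : ℝ) ≠ 0 := Nat.cast_ne_zero.2 hN
  field_simp
  linear_combination h_loop

theorem jacobiMoment_positive_loop_equation (hN : N ≠ 0) (ha : 0 < a) (hb : 0 < b) (m : ℕ)
    (l : Multiset ℕ) :
    ((a + b - 2) / N + 2) * jacobiMoment N ((m + 1) ::ₘ l) a b +
        ((positiveSplits m l).map fun t => jacobiMoment N t a b).sum +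
        ((N : ℝ) ^ 2)⁻¹ * ((joins (m + 1) l).map fun t => jacobiMoment N t a b).sum =
      (a - 1) / N * jacobiMoment N (m ::ₘ l) a b +
        ((splits m l).map fun t => jacobiMoment N t a b).sum +
        ((N : ℝ) ^ 2)⁻¹ * ((joins m l).map fun t => jacobiMoment N t a b).sum := by
  rw [← jacobiMoment_loop_equation hN ha hb, splits_succ, Multiset.map_add, Multiset.sum_add,
    Multiset.map_replicate, Multiset.sum_replicate, jacobiMoment_zero_cons hN, nsmul_eq_mul]
  push_cast
  ring

end JacobiMoments

section RationalContinuation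

open MvPolynomial

variable {F G : ℝ → ℝ → ℝ} {a b c d : ℝ}

/-- `c` is the value at `(a, b)` of the rational function that extends `F` beyond the open positive
quadrant; `IsContinuedRatio N k` is the case `F = selbergRatio N k`. -/
def IsRationalContinuation (F : ℝ → ℝ → ℝ) (a b c : ℝ) : Prop :=
  ∃ P Q : MvPolynomial (Fin 2) ℝ, eval ![a, b] Q ≠ 0 ∧
    (∀ a' b' : ℝ, 0 < a' → 0 < b' → eval ![a', b'] Q ≠ 0 →
      F a' b' = eval ![a', b'] P / eval ![a', b'] Q) ∧
    c = eval ![a, b] P / eval ![a, b] Q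

theorem eq_of_eval_eq_on_quadrant {P Q : MvPolynomial (Fin 2) ℝ}
    (h : ∀ a b : ℝ, 0 < a → 0 < b → eval ![a, b] P = eval ![a, b] Q) : P = Q := by
  refine funext_set (fun _ => Set.Ioi 0) (fun _ => Set.Ioi_infinite 0) fun x hx => ?_
  rw [← FinVec.etaExpand_eq x]
  exact h _ _ (hx 0 trivial) (hx 1 trivial)

namespace IsRationalContinuation

theorem congr (h : IsRationalContinuation F a b c)
    (hFG : ∀ x y, 0 < x → 0 < y → F x y = G x y) : IsRationalContinuation G a b c := by
  obtain ⟨P, Q, hQ, hF, hc⟩ := h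
  exact ⟨P, Q, hQ, fun x y hx hy hxy => by rw [← hFG x y hx hy, hF x y hx hy hxy], hc⟩

theorem unique (hc : IsRationalContinuation F a b c) (hd : IsRationalContinuation F a b d) :
    c = d := by
  obtain ⟨P, Q, hQ, hF, rfl⟩ := hc
  obtain ⟨P', Q', hQ', hF', rfl⟩ := hd
  have h_cross : P * Q' * (Q * Q') = P' * Q * (Q * Q') := by
    refine eq_of_eval_eq_on_quadrant fun x y hx hy => ?_
    simp only [map_mul]
    rcases eq_or_ne (eval ![x, y] Q) 0 with hq | hq
    · simp [hq]
    rcases eq_or_ne (eval ![x, y] Q') 0 with hq' | hq'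
    · simp [hq']
    rw [(div_eq_div_iff hq hq').1 ((hF x y hx hy hq).symm.trans (hF' x y hx hy hq'))]
  have h_eval := congrArg (eval ![a, b]) h_cross
  simp only [map_mul] at h_eval
  exact (div_eq_div_iff hQ hQ').2 (mul_right_cancel₀ (mul_ne_zero hQ hQ') h_eval)

theorem of_polynomial (P : MvPolynomial (Fin 2) ℝ) (a b : ℝ) :
    IsRationalContinuation (fun x y => eval ![x, y] P) a b (eval ![a, b] P) :=
  ⟨P, 1, by simp, by simp, by simp⟩

theorem add (hF : IsRationalContinuation F a b c) (hG : IsRationalContinuation G a b d) :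
    IsRationalContinuation (fun x y => F x y + G x y) a b (c + d) := by
  obtain ⟨P, Q, hQ, hF, rfl⟩ := hF
  obtain ⟨P', Q', hQ', hG, rfl⟩ := hG
  refine ⟨P * Q' + Q * P', Q * Q', by simp [hQ, hQ'], fun x y hx hy hxy => ?_, ?_⟩
  · obtain ⟨hq, hq'⟩ := mul_ne_zero_iff.1 (map_mul (eval ![x, y]) Q Q' ▸ hxy)
    simp only [hF x y hx hy hq, hG x y hx hy hq', div_add_div _ _ hq hq', map_add, map_mul]
  · simp only [div_add_div _ _ hQ hQ', map_add, map_mul]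

theorem mul (hF : IsRationalContinuation F a b c) (hG : IsRationalContinuation G a b d) :
    IsRationalContinuation (fun x y => F x y * G x y) a b (c * d) := by
  obtain ⟨P, Q, hQ, hF, rfl⟩ := hF
  obtain ⟨P', Q', hQ', hG, rfl⟩ := hG
  refine ⟨P * P', Q * Q', by simp [hQ, hQ'], fun x y hx hy hxy => ?_, ?_⟩
  · obtain ⟨hq, hq'⟩ := mul_ne_zero_iff.1 (map_mul (eval ![x, y]) Q Q' ▸ hxy)
    simp only [hF x y hx hy hq, hG x y hx hy hq', div_mul_div_comm, map_mul]
  · simp only [div_mul_div_comm, map_mul]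

theorem of_polynomial_mul {Q : MvPolynomial (Fin 2) ℝ} (hQ : eval ![a, b] Q ≠ 0)
    (h : IsRationalContinuation (fun x y => eval ![x, y] Q * F x y) a b c) :
    IsRationalContinuation F a b (c / eval ![a, b] Q) := by
  obtain ⟨P, R, hR, hF, rfl⟩ := h
  refine ⟨P, R * Q, by simp [hR, hQ], fun x y hx hy hxy => ?_, by rw [map_mul, div_div]⟩
  obtain ⟨hr, hq⟩ := mul_ne_zero_iff.1 (map_mul (eval ![x, y]) R Q ▸ hxy)
  rw [map_mul, ← div_div, ← hF x y hx hy hr, mul_div_cancel_left₀ _ hq]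

end IsRationalContinuation

end RationalContinuation

section ContinuationTendsto

open MvPolynomial Matrix

theorem adjugate_mulVec_mulVec {ι R : Type*} [Fintype ι] [DecidableEq ι] [CommRing R]
    (A : Matrix ι ι R) (v : ι → R) : A.adjugate *ᵥ (A *ᵥ v) = A.det • v := by
  rw [mulVec_mulVec, adjugate_mul, smul_mulVec, one_mulVec]

variable {σ : Type*} {l : Filter σ} {a b : σ → ℝ} {F G : σ → ℝ → ℝ → ℝ} {L K : ℝ}

/-- The rational continuations of the functions `F n`, evaluated at `(a n, b n)`, exist eventually
along `l` and tend to `L`. -/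
def ContinuationTendsto (F : σ → ℝ → ℝ → ℝ) (a b : σ → ℝ) (l : Filter σ) (L : ℝ) : Prop :=
  ∃ c : σ → ℝ, (∀ᶠ n in l, IsRationalContinuation (F n) (a n) (b n) (c n)) ∧ Tendsto c l (𝓝 L)

namespace ContinuationTendsto

theorem congr (h : ContinuationTendsto F a b l L)
    (hFG : ∀ᶠ n in l, ∀ x y, 0 < x → 0 < y → F n x y = G n x y) :
    ContinuationTendsto G a b l L := by
  obtain ⟨c, hc, hcL⟩ := h
  exact ⟨c, by filter_upwards [hc, hFG] with n hn hFGn using hn.congr hFGn, hcL⟩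

theorem of_polynomial {P : σ → MvPolynomial (Fin 2) ℝ}
    (h : Tendsto (fun n => eval ![a n, b n] (P n)) l (𝓝 L)) :
    ContinuationTendsto (fun n x y => eval ![x, y] (P n)) a b l L :=
  ⟨_, .of_forall fun n => .of_polynomial (P n) (a n) (b n), h⟩

theorem of_tendsto {r : σ → ℝ} (h : Tendsto r l (𝓝 L)) :
    ContinuationTendsto (fun n _ _ => r n) a b l L := by
  simpa only [eval_C] using of_polynomial (a := a) (b := b) (P := fun n => C (r n)) (by simpa)

theorem add (hF : ContinuationTendsto F a b l L) (hG : ContinuationTendsto G a b l K) :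
    ContinuationTendsto (fun n x y => F n x y + G n x y) a b l (L + K) := by
  obtain ⟨c, hc, hcL⟩ := hF
  obtain ⟨d, hd, hdK⟩ := hG
  exact ⟨_, by filter_upwards [hc, hd] with n hcn hdn using hcn.add hdn, hcL.add hdK⟩

theorem mul (hF : ContinuationTendsto F a b l L) (hG : ContinuationTendsto G a b l K) :
    ContinuationTendsto (fun n x y => F n x y * G n x y) a b l (L * K) := by
  obtain ⟨c, hc, hcL⟩ := hF
  obtain ⟨d, hd, hdK⟩ := hG
  exact ⟨_, by filter_upwards [hc, hd] with n hcn hdn using hcn.mul hdn, hcL.mul hdK⟩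

theorem multiset_sum {α : Type*} {T : Multiset α} {f : α → σ → ℝ → ℝ → ℝ} {w : α → ℝ}
    (h : ∀ t ∈ T, ContinuationTendsto (f t) a b l (w t)) :
    ContinuationTendsto (fun n x y => (T.map fun t => f t n x y).sum) a b l (T.map w).sum := by
  induction T using Multiset.induction with
  | empty => simpa using of_tendsto tendsto_const_nhds
  | cons t T ih =>
    simp only [Multiset.map_cons, Multiset.sum_cons]
    exact (h t (Multiset.mem_cons_self t T)).add
      (ih fun t' ht' => h t' (Multiset.mem_cons_of_mem ht'))

theorem of_polynomial_mul {Q : σ → MvPolynomial (Fin 2) ℝ} {q : ℝ} (hq : q ≠ 0)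
    (hQ : Tendsto (fun n => eval ![a n, b n] (Q n)) l (𝓝 q))
    (h : ContinuationTendsto (fun n x y => eval ![x, y] (Q n) * F n x y) a b l L) :
    ContinuationTendsto F a b l (L / q) := by
  obtain ⟨c, hc, hcL⟩ := h
  exact ⟨_, by filter_upwards [hc, hQ.eventually_ne hq] with n hcn hQn using
    hcn.of_polynomial_mul hQn, hcL.div hQ hq⟩

/-- Cramer's rule: the denominator is the polynomial `det (M n)`, which tends to `det A ≠ 0`. -/
theorem of_mulVec {ι : Type*} [Fintype ι] [DecidableEq ι]
    {M : σ → Matrix ι ι (MvPolynomial (Fin 2) ℝ)} {A : Matrix ι ι ℝ} {e : ι → σ → ℝ → ℝ → ℝ}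
    {ρ : ι → ℝ} (hA : A.det ≠ 0)
    (hM : Tendsto (fun n => (eval ![a n, b n]).mapMatrix (M n)) l (𝓝 A))
    (h : ∀ i, ContinuationTendsto
      (fun n x y => ((eval ![x, y]).mapMatrix (M n) *ᵥ fun j => e j n x y) i) a b l ((A *ᵥ ρ) i))
    (i : ι) :
    ContinuationTendsto (e i) a b l (ρ i) := by
  have h_det : Tendsto (fun n => eval ![a n, b n] (M n).det) l (𝓝 A.det) := by
    simp only [RingHom.map_det]
    exact ((Continuous.matrix_det continuous_id).tendsto A).comp hM
  have h_adjugate (j : ι) :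
      Tendsto (fun n => eval ![a n, b n] ((M n).adjugate i j)) l (𝓝 (A.adjugate i j)) := by
    refine (((Continuous.matrix_adjugate continuous_id).matrix_elem i j).tendsto A).comp hM
      |>.congr fun n => ?_
    exact congrFun₂ (RingHom.map_adjugate (eval ![a n, b n]) (M n)).symm i j
  have h_numerator := multiset_sum (T := Finset.univ.val) fun j _ =>
    (of_polynomial (h_adjugate j)).mul (h j)
  have h_limit := congrFun (adjugate_mulVec_mulVec A ρ) i
  rw [← mul_div_cancel_left₀ (ρ i) hA]
  refine of_polynomial_mul hA h_det ?_
  rw [← smul_eq_mul, ← Pi.smul_apply, ← h_limit]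
  refine h_numerator.congr (.of_forall fun n x y _ _ => ?_)
  have h_cramer := congrFun (adjugate_mulVec_mulVec ((eval ![x, y]).mapMatrix (M n))
    fun j => e j n x y) i
  rw [← RingHom.map_adjugate, ← RingHom.map_det] at h_cramer
  exact h_cramer

end ContinuationTendsto

end ContinuationTendsto

section PartitionMatrices

open Matrix

theorem prod_map_filter_ne_zero {M : Type*} [CommMonoid M] {f : ℕ → M} (hf : f 0 = 1)
    (s : Multiset ℕ) : ((s.filter (· ≠ 0)).map f).prod = (s.map f).prod := by
  induction s using Multiset.induction with
  | empty => rfl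
  | cons i s ih =>
    by_cases hi : i = 0 <;> simp [hi, hf, ih]

theorem exists_parts_eq_succ_cons {n : ℕ} (q : (n + 1).Partition) :
    ∃ m l, q.parts = (m + 1) ::ₘ l := by
  have h_ne : q.parts ≠ 0 := fun h => by
    simpa [h] using q.parts_sum
  obtain ⟨i, hi⟩ := Multiset.exists_mem_of_ne_zero h_ne
  obtain ⟨l, hl⟩ := Multiset.exists_cons_of_mem hi
  exact ⟨i - 1, l, by rw [hl, Nat.sub_add_cancel (q.parts_pos hi)]⟩

/-- The matrix on the partitions of `n` whose row `q` counts the occurrences of each partition in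
the multiset `T q`. -/
def countMatrix (R : Type*) [NatCast R] {n : ℕ} (T : n.Partition → Multiset (Multiset ℕ)) :
    Matrix n.Partition n.Partition R :=
  .of fun q q' => ((T q).count q'.parts : R)

variable {n : ℕ} {T : n.Partition → Multiset (Multiset ℕ)}

theorem countMatrix_mulVec {R : Type*} [CommSemiring R]
    (hT : ∀ q, ∀ t ∈ T q, t.sum = n ∧ ∀ i ∈ t, 0 < i) (f : Multiset ℕ → R) (q : n.Partition) :
    (countMatrix R T *ᵥ fun q' => f q'.parts) q = ((T q).map f).sum := by
  let parts : n.Partition ↪ Multiset ℕ := ⟨Nat.Partition.parts, fun _ _ => Nat.Partition.ext⟩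
  have h_subset : (T q).toFinset ⊆ Finset.univ.map parts := fun t ht => by
    obtain ⟨h_sum, h_pos⟩ := hT q t (Multiset.mem_toFinset.1 ht)
    exact Finset.mem_map.2 ⟨⟨t, h_pos _, h_sum⟩, Finset.mem_univ _, rfl⟩
  rw [Finset.sum_multiset_map_count, Finset.sum_subset h_subset fun t _ ht => by
    rw [Multiset.count_eq_zero.2 (mt Multiset.mem_toFinset.2 ht), zero_nsmul], Finset.sum_map]
  simp only [nsmul_eq_mul]
  rfl

theorem mapMatrix_countMatrix {R S : Type*} [NonAssocSemiring R] [NonAssocSemiring S]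
    (φ : R →+* S) : φ.mapMatrix (countMatrix R T) = countMatrix S T := by
  ext q q'
  exact map_natCast φ _

theorem det_smul_one_add_of_grading {ι R : Type*} [Fintype ι] [DecidableEq ι] [CommRing R]
    {S : Matrix ι ι R} (grade : ι → ℕ) (hS : ∀ i j, grade j ≤ grade i → S i j = 0) (γ : R) :
    (γ • 1 + S).det = ∏ d ∈ Finset.univ.image grade, γ ^ Fintype.card {i // grade i = d} := by
  have h_triangular : (γ • 1 + S).BlockTriangular grade := fun i j hij => by
    have h_ne : i ≠ j := fun h => hij.ne' (congrArg grade h)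
    simp [one_apply_ne h_ne, hS i j hij.le]
  rw [h_triangular.det]
  refine Finset.prod_congr rfl fun d _ => ?_
  have h_block : (γ • 1 + S).toSquareBlock grade d = γ • 1 := by
    ext i j
    simp [toSquareBlock_def, hS i j (j.2.trans i.2.symm).le, one_apply, Subtype.ext_iff]
  rw [h_block, det_smul, det_one, mul_one]

end PartitionMatrices

section PlanarLimit

open MvPolynomial Matrix Finset.HasAntidiagonal

variable {α β : ℝ} {μ : ℕ → ℝ}

/-- `μ` is a normalised solution of the large-`N` limit of the Jacobi loop equations, in which the
moments factorise and the joins disappear; `α` and `β` are the limits of `a / N` and `b / N`. -/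
structure IsPlanarSolution (α β : ℝ) (μ : ℕ → ℝ) : Prop where
  zero : μ 0 = 1
  loop_equation (m : ℕ) :
    (α + β) * μ (m + 1) + ∑ p ∈ antidiagonal (m + 1), μ p.1 * μ p.2 =
      α * μ m + ∑ p ∈ antidiagonal m, μ p.1 * μ p.2

theorem IsPlanarSolution.positive_loop_equation (hμ : IsPlanarSolution α β μ) (m : ℕ)
    (l : Multiset ℕ) :
    (α + β + 2) * (((m + 1) ::ₘ l).map μ).prod +
        ((positiveSplits m l).map fun t => (t.map μ).prod).sum =
      α * ((m ::ₘ l).map μ).prod + ((splits m l).map fun t => (t.map μ).prod).sum := by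
  have h_splits := sum_map_prod_splits μ (m + 1) l
  rw [splits_succ, Multiset.map_add, Multiset.sum_add, Multiset.map_replicate,
    Multiset.sum_replicate, Multiset.map_cons, Multiset.prod_cons, hμ.zero, one_mul,
    nsmul_eq_mul] at h_splits
  rw [sum_map_prod_splits]
  simp only [Multiset.map_cons, Multiset.prod_cons] at h_splits ⊢
  push_cast at h_splits
  linear_combination (l.map μ).prod * hμ.loop_equation m + h_splits

theorem jacobiMoment_filter_ne_zero {N : ℕ} (hN : N ≠ 0) (s : Multiset ℕ) (a b : ℝ) :
    jacobiMoment N (s.filter (· ≠ 0)) a b = jacobiMoment N s a b := by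
  rw [jacobiMoment, prod_map_filter_ne_zero (empiricalMoment_zero hN), jacobiMoment]

variable {a b : ℕ → ℝ}

theorem tendsto_sub_one_div (ha : Tendsto (fun N => a N / N) atTop (𝓝 α)) :
    Tendsto (fun N => (a N - 1) / N) atTop (𝓝 α) := by
  simpa only [sub_div, sub_zero] using ha.sub tendsto_one_div_atTop_nhds_zero_nat

theorem tendsto_inv_sq_atTop_nhds_zero_nat :
    Tendsto (fun N : ℕ => ((N : ℝ) ^ 2)⁻¹) atTop (𝓝 0) :=
  tendsto_inv_atTop_zero.comp
    ((tendsto_pow_atTop two_ne_zero).comp tendsto_natCast_atTop_atTop)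

theorem continuationTendsto_of_partition (hμ : μ 0 = 1) {n : ℕ}
    (h : ∀ q : n.Partition,
      ContinuationTendsto (fun N => jacobiMoment N q.parts) a b atTop (q.parts.map μ).prod)
    {s : Multiset ℕ} (hs : s.sum = n) :
    ContinuationTendsto (fun N => jacobiMoment N s) a b atTop (s.map μ).prod := by
  have h_parts := h (.ofSums n s hs)
  rw [Nat.Partition.ofSums, prod_map_filter_ne_zero hμ] at h_parts
  exact h_parts.congr ((eventually_ne_atTop 0).mono fun N hN x y _ _ =>
    jacobiMoment_filter_ne_zero hN s x y)

theorem continuationTendsto_loop_equation_rhs {n : ℕ}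
    (ha : Tendsto (fun N => a N / N) atTop (𝓝 α))
    (h : ∀ s : Multiset ℕ, s.sum = n →
      ContinuationTendsto (fun N => jacobiMoment N s) a b atTop (s.map μ).prod)
    {m : ℕ} {l : Multiset ℕ} (hml : m + l.sum = n) :
    ContinuationTendsto (fun N x y => (x - 1) / N * jacobiMoment N (m ::ₘ l) x y +
        ((splits m l).map fun t => jacobiMoment N t x y).sum +
        ((N : ℝ) ^ 2)⁻¹ * ((joins m l).map fun t => jacobiMoment N t x y).sum) a b atTop
      (α * ((m ::ₘ l).map μ).prod + ((splits m l).map fun t => (t.map μ).prod).sum) := by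
  have h_coefficient : ContinuationTendsto (fun (N : ℕ) x _ => (x - 1) / N) a b atTop α := by
    have h_eval (N : ℕ) (x y : ℝ) : eval ![x, y] (C (N : ℝ)⁻¹ * (X 0 - 1)) = (x - 1) / N := by
      simp [div_eq_inv_mul]
    refine (ContinuationTendsto.of_polynomial ?_).congr (.of_forall fun N x y _ _ => h_eval N x y)
    simpa only [h_eval] using tendsto_sub_one_div ha
  have h_inv_sq : ContinuationTendsto (fun (N : ℕ) _ _ => ((N : ℝ) ^ 2)⁻¹) a b atTop 0 :=
    .of_tendsto tendsto_inv_sq_atTop_nhds_zero_nat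
  have h_moment := h (m ::ₘ l) ((Multiset.sum_cons m l).trans hml)
  have h_splits := ContinuationTendsto.multiset_sum (T := splits m l) fun t ht =>
    h t ((sum_of_mem_splits ht).trans hml)
  have h_joins := ContinuationTendsto.multiset_sum (T := joins m l) fun t ht =>
    h t ((sum_of_mem_joins ht).trans hml)
  simpa only [zero_mul, add_zero] using
    ((h_coefficient.mul h_moment).add h_splits).add (h_inv_sq.mul h_joins)

/-- The matrix of the loop equations at a given weight `n`, in the variables `X 0 = a` and
`X 1 = b`: the rows `q` of `S` and `J` list the splits and the joins of the partition `q`. -/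
noncomputable def loopMatrix {n : ℕ} (S J : n.Partition → Multiset (Multiset ℕ)) (N : ℕ) :
    Matrix n.Partition n.Partition (MvPolynomial (Fin 2) ℝ) :=
  (C (N : ℝ)⁻¹ * (X 0 + X 1 - 2) + 2 : MvPolynomial (Fin 2) ℝ) •
      (1 : Matrix n.Partition n.Partition (MvPolynomial (Fin 2) ℝ)) +
    countMatrix (MvPolynomial (Fin 2) ℝ) S +
    (C ((N : ℝ) ^ 2)⁻¹ : MvPolynomial (Fin 2) ℝ) • countMatrix (MvPolynomial (Fin 2) ℝ) J

theorem mapMatrix_eval_loopMatrix {n : ℕ} (S J : n.Partition → Multiset (Multiset ℕ)) (N : ℕ)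
    (x y : ℝ) :
    (eval ![x, y]).mapMatrix (loopMatrix S J N) =
      ((x + y - 2) / N + 2) • 1 + countMatrix ℝ S + ((N : ℝ) ^ 2)⁻¹ • countMatrix ℝ J := by
  have h_smul (p : MvPolynomial (Fin 2) ℝ) (A : Matrix n.Partition n.Partition _) :
      (eval ![x, y]).mapMatrix (p • A) = eval ![x, y] p • (eval ![x, y]).mapMatrix A :=
    Matrix.ext fun i j => map_mul (eval ![x, y]) p (A i j)
  rw [loopMatrix, map_add, map_add, h_smul, h_smul, map_one, mapMatrix_countMatrix,
    mapMatrix_countMatrix]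
  simp [div_eq_inv_mul]

theorem tendsto_mapMatrix_eval_loopMatrix {n : ℕ} (S J : n.Partition → Multiset (Multiset ℕ))
    (ha : Tendsto (fun N => a N / N) atTop (𝓝 α)) (hb : Tendsto (fun N => b N / N) atTop (𝓝 β)) :
    Tendsto (fun N => (eval ![a N, b N]).mapMatrix (loopMatrix S J N)) atTop
      (𝓝 ((α + β + 2) • 1 + countMatrix ℝ S)) := by
  have h_coefficient : Tendsto (fun N => (a N + b N - 2) / N + 2) atTop (𝓝 (α + β + 2)) := by
    refine (((tendsto_sub_one_div ha).add (tendsto_sub_one_div hb)).add_const 2).congr fun N => ?_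
    ring
  simp only [mapMatrix_eval_loopMatrix]
  simpa only [zero_smul, add_zero] using ((h_coefficient.smul_const _).add_const _).add
    (tendsto_inv_sq_atTop_nhds_zero_nat.smul_const (countMatrix ℝ J))

theorem continuationTendsto_jacobiMoment_succ (hμ : IsPlanarSolution α β μ)
    (hγ : α + β + 2 ≠ 0) (ha : Tendsto (fun N => a N / N) atTop (𝓝 α))
    (hb : Tendsto (fun N => b N / N) atTop (𝓝 β)) {n : ℕ}
    (h : ∀ s : Multiset ℕ, s.sum = n →
      ContinuationTendsto (fun N => jacobiMoment N s) a b atTop (s.map μ).prod)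
    (q : (n + 1).Partition) :
    ContinuationTendsto (fun N => jacobiMoment N q.parts) a b atTop (q.parts.map μ).prod := by
  choose m l hq using exists_parts_eq_succ_cons (n := n)
  have h_pos (q) : ∀ i ∈ l q, 0 < i := fun i hi =>
    q.parts_pos (hq q ▸ Multiset.mem_cons_of_mem hi)
  have h_sum (q) : m q + 1 + (l q).sum = n + 1 := by
    rw [← Multiset.sum_cons, ← hq, q.parts_sum]
  have h_splits (q) : ∀ t ∈ positiveSplits (m q) (l q), t.sum = n + 1 ∧ ∀ i ∈ t, 0 < i :=
    fun t ht => ⟨(sum_of_mem_positiveSplits ht).trans (h_sum q),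
      pos_of_mem_positiveSplits ht (h_pos q)⟩
  have h_joins (q) : ∀ t ∈ joins (m q + 1) (l q), t.sum = n + 1 ∧ ∀ i ∈ t, 0 < i :=
    fun t ht => ⟨(sum_of_mem_joins ht).trans (h_sum q), pos_of_mem_joins ht (h_pos q)⟩
  have h_det : ((α + β + 2) • 1 +
      countMatrix ℝ fun q => positiveSplits (m q) (l q)).det ≠ 0 := by
    rw [det_smul_one_add_of_grading fun q => q.parts.card]
    · exact Finset.prod_ne_zero_iff.2 fun _ _ => pow_ne_zero _ hγ
    · intro q q' h_card
      refine Nat.cast_eq_zero.2 (Multiset.count_eq_zero.2 fun h_mem => ?_)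
      rw [card_of_mem_positiveSplits h_mem, hq q, Multiset.card_cons] at h_card
      omega
  refine ContinuationTendsto.of_mulVec (e := fun q N => jacobiMoment N q.parts)
    (ρ := fun q => (q.parts.map μ).prod) h_det
    (tendsto_mapMatrix_eval_loopMatrix _ (fun q => joins (m q + 1) (l q)) ha hb)
    (fun q => ?_) q
  have h_rhs := continuationTendsto_loop_equation_rhs (m := m q) (l := l q) ha h
    (by have := h_sum q; omega)
  rw [add_mulVec, smul_mulVec, one_mulVec, Pi.add_apply, Pi.smul_apply, smul_eq_mul,
    countMatrix_mulVec h_splits fun t => (t.map μ).prod, hq, hμ.positive_loop_equation]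
  refine h_rhs.congr ((eventually_ne_atTop 0).mono fun N hN x y hx hy => ?_)
  rw [← jacobiMoment_positive_loop_equation hN hx hy, ← hq, mapMatrix_eval_loopMatrix,
    add_mulVec, add_mulVec, smul_mulVec, smul_mulVec, one_mulVec]
  simp only [Pi.add_apply, Pi.smul_apply, smul_eq_mul]
  rw [countMatrix_mulVec h_splits (jacobiMoment N · x y),
    countMatrix_mulVec h_joins (jacobiMoment N · x y)]

theorem continuationTendsto_jacobiMoment (hμ : IsPlanarSolution α β μ) (hγ : α + β + 2 ≠ 0)
    (ha : Tendsto (fun N => a N / N) atTop (𝓝 α)) (hb : Tendsto (fun N => b N / N) atTop (𝓝 β))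
    (s : Multiset ℕ) :
    ContinuationTendsto (fun N => jacobiMoment N s) a b atTop (s.map μ).prod := by
  suffices h : ∀ (n : ℕ) (q : n.Partition),
      ContinuationTendsto (fun N => jacobiMoment N q.parts) a b atTop (q.parts.map μ).prod from
    continuationTendsto_of_partition hμ.zero (h s.sum) rfl
  intro n
  induction n with
  | zero =>
    intro q
    rw [Nat.Partition.partition_zero_parts, Multiset.map_zero, Multiset.prod_zero]
    exact (ContinuationTendsto.of_tendsto tendsto_const_nhds).congr
      (.of_forall fun N x y hx hy => (jacobiMoment_zero hx hy).symm)
  | succ n ih =>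
    exact continuationTendsto_jacobiMoment_succ hμ hγ ha hb fun s hs =>
      continuationTendsto_of_partition hμ.zero ih hs

end PlanarLimit

section SelbergI

open MvPolynomial Finset.HasAntidiagonal

variable {N k : ℕ} {x y c α β : ℝ} {μ : ℕ → ℝ} {a b : ℕ → ℝ}

theorem isContinuedRatio_mul_of_jacobiMoment (hN : N ≠ 0)
    (h : IsRationalContinuation (jacobiMoment N {k}) x y c) : IsContinuedRatio N k x y (N * c) := by
  have h_mul := (IsRationalContinuation.of_polynomial (C (N : ℝ)) x y).mul h
  simp only [eval_C] at h_mul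
  exact h_mul.congr fun _ _ hx hy => (selbergRatio_eq_mul_jacobiMoment hN hx hy k).symm

theorem existsUnique_isContinuedRatio (h : IsContinuedRatio N k x y c) :
    ∃! c, IsContinuedRatio N k x y c :=
  ⟨c, h, fun _ hd => IsRationalContinuation.unique hd h⟩

theorem selbergI_eq (h : IsContinuedRatio N k x y c) : selbergI N k x y = c := by
  have h_exists : ∃ c, IsContinuedRatio N k x y c := ⟨c, h⟩
  rw [selbergI, dif_pos h_exists]
  exact IsRationalContinuation.unique h_exists.choose_spec h

theorem IsPlanarSolution.tendsto_selbergI_div (hμ : IsPlanarSolution α β μ) (hγ : α + β + 2 ≠ 0)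
    (ha : Tendsto (fun N => a N / N) atTop (𝓝 α)) (hb : Tendsto (fun N => b N / N) atTop (𝓝 β))
    (k : ℕ) :
    (∀ᶠ N in atTop, ∃! c, IsContinuedRatio N k (a N) (b N) c) ∧
      Tendsto (fun N => selbergI N k (a N) (b N) / N) atTop (𝓝 (μ k)) := by
  obtain ⟨c, hc, h_limit⟩ := continuationTendsto_jacobiMoment hμ hγ ha hb {k}
  rw [Multiset.map_singleton, Multiset.prod_singleton] at h_limit
  have h_ratio : ∀ᶠ N : ℕ in atTop, N ≠ 0 ∧ IsContinuedRatio N k (a N) (b N) (N * c N) := by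
    filter_upwards [hc, eventually_ne_atTop 0] with N hcN hN
    exact ⟨hN, isContinuedRatio_mul_of_jacobiMoment hN hcN⟩
  refine ⟨h_ratio.mono fun N hN => existsUnique_isContinuedRatio hN.2, h_limit.congr' ?_⟩
  filter_upwards [h_ratio] with N ⟨hN, h⟩
  rw [selbergI_eq h, mul_div_cancel_left₀ _ (Nat.cast_ne_zero.2 hN)]

/-- The moments of the Dirac mass at `0`. -/
theorem isPlanarSolution_single (β : ℝ) : IsPlanarSolution (-1) β (Pi.single 0 1) where
  zero := Pi.single_eq_same 0 1
  loop_equation m := by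
    have h_sum (j : ℕ) : ∑ p ∈ antidiagonal j,
        (Pi.single 0 1 : ℕ → ℝ) p.1 * (Pi.single 0 1 : ℕ → ℝ) p.2 =
          (Pi.single 0 1 : ℕ → ℝ) j := by
      rw [Finset.Nat.sum_antidiagonal_eq_sum_range_succ_mk, Finset.sum_range_succ']
      simp [Pi.single_apply]
    rw [h_sum, h_sum, Pi.single_eq_of_ne m.succ_ne_zero]
    ring

/-- The moments of the Dirac mass at `1`. -/
theorem isPlanarSolution_one (α : ℝ) : IsPlanarSolution α (-1) 1 where
  zero := rfl
  loop_equation m := by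
    simp only [Pi.one_apply, mul_one, Finset.sum_const, Finset.Nat.card_antidiagonal, nsmul_eq_mul]
    push_cast
    ring

theorem tendsto_mul_natCast_add_div (x y : ℝ) :
    Tendsto (fun N : ℕ => (x * N + y) / N) atTop (𝓝 x) := by
  have h_limit := (tendsto_const_nhds (x := x)).add (tendsto_const_div_atTop_nhds_zero_nat y)
  rw [add_zero] at h_limit
  refine h_limit.congr' ((eventually_ne_atTop 0).mono fun N hN => ?_)
  have hN' : (N : ℝ) ≠ 0 := Nat.cast_ne_zero.2 hN
  field_simp

end SelbergI

theorem mainTheorem5_general {k : ℕ} (hk : 0 < k) {a b : ℕ → ℝ} {α β : ℝ}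
    (ha : Tendsto (fun N => a N / N) atTop (𝓝 α)) (hb : Tendsto (fun N => b N / N) atTop (𝓝 β)) :
    (α = -1 → β ≠ -1 →
      (∀ᶠ N : ℕ in atTop, ∃! c, IsContinuedRatio N k (a N) (b N) c) ∧
        Tendsto (fun N : ℕ => selbergI N k (a N) (b N) / (N : ℝ)) atTop (𝓝 0)) ∧
    (β = -1 → α ≠ -1 →
      (∀ᶠ N : ℕ in atTop, ∃! c, IsContinuedRatio N k (a N) (b N) c) ∧
        Tendsto (fun N : ℕ => selbergI N k (a N) (b N) / (N : ℝ)) atTop (𝓝 1)) := by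
  constructor
  · rintro rfl hβ
    have hγ : -1 + β + 2 ≠ 0 := fun h => hβ (by linarith)
    simpa only [Pi.single_eq_of_ne hk.ne'] using
      (isPlanarSolution_single β).tendsto_selbergI_div hγ ha hb k
  · rintro rfl hα
    have hγ : α + -1 + 2 ≠ 0 := fun h => hα (by linarith)
    simpa only [Pi.one_apply] using (isPlanarSolution_one α).tendsto_selbergI_div hγ ha hb k

theorem mainTheorem5 (k : ℕ) (hk : 0 < k) (a₀ a₁ b₀ b₁ : ℝ) :
    (a₁ = -1 → b₁ ≠ -1 →
      (∀ᶠ N : ℕ in atTop, ∃! c, IsContinuedRatio N k (a₁ * N + a₀) (b₁ * N + b₀) c) ∧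
      Tendsto (fun N : ℕ => selbergI N k (a₁ * N + a₀) (b₁ * N + b₀) / (N : ℝ)) atTop (𝓝 0)) ∧
    (b₁ = -1 → a₁ ≠ -1 →
      (∀ᶠ N : ℕ in atTop, ∃! c, IsContinuedRatio N k (a₁ * N + a₀) (b₁ * N + b₀) c) ∧
      Tendsto (fun N : ℕ => selbergI N k (a₁ * N + a₀) (b₁ * N + b₀) / (N : ℝ)) atTop (𝓝 1)) :=
  mainTheorem5_general hk (tendsto_mul_natCast_add_div a₁ a₀) (tendsto_mul_natCast_add_div b₁ b₀)
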